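/- Let $N\ge 1$, $\kappa\in\mathbb R$ and $\Omega=(\nu_1,\dots,\nu_N)\in\mathbb R^N$ be fixed. On the torus $\mathbb T^N=(\mathbb R/2\pi\mathbb Z)^N$, with the Lebesgue measure $m$ normalized so that $m(\mathbb T^N)=(2\pi)^N$, let $\Phi_t$ be the flow of the Kuramoto model $$\dot\theta_i=\nu_i+\frac{\kappa}{N}\sum_{j=1}^N\sin(\theta_j-\theta_i),\qquad i=1,\dots,N,$$ that is, $t\mapsto\Phi_t(\Theta^0)$ is the unique global solution with initial datum $\Theta^0\in\mathbb T^N$. Let $$R(\Theta)=\Big|\frac1N\sum_{j=1}^N e^{\mathrm i\theta_j}\Big|$$ be the order parameter of $\Theta=(\theta_1,\dots,\theta_N)\in\mathbb T^N$. Then the following hold. 1. If $\kappa>0$, then for every real number $R_*<\frac1{\sqrt N}$ the set $$U_{R_*}^\infty=\{\Theta^0\in\mathbb T^N:\ R(\Phi_t(\Theta^0))<R_*\ \text{for all } t\ge 0\}$$ is a Borel set and $m(U_{R_*}^\infty)=0$. 2. If $\kappa<0$, then for every real number $R_*>\frac1{\sqrt N}$ the set $$V_{R_*}^\infty=\{\Theta^0\in\mathbb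 T^N:\ R(\Phi_t(\Theta^0))>R_*\ \text{for all } t\ge 0\}$$ is a Borel set and $m(V_{R_*}^\infty)=0$. -/

import Mathlib

noncomputable section

namespace Kuramoto

/-- `2π > 0`, so that `ℝ / 2πℤ` carries its standard Lebesgue measure, of total mass `2π`. -/
instance fact_two_pi_pos : Fact (0 < 2 * Real.pi) := ⟨Real.two_pi_pos⟩

/-- The torus `𝕋^N = (ℝ / 2πℤ)^N`. Its measure `volume` is the product of the Lebesgue measures of
the factors, of total mass `(2π)^N`. -/
abbrev Torus (N : ℕ) : Type := Fin N → AddCircle (2 * Real.pi)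

/-- The sine of an element of `ℝ / 2πℤ`. -/
def sinT : AddCircle (2 * Real.pi) → ℝ := Real.sin_periodic.lift

/-- `e^{iθ}` for an element `θ` of `ℝ / 2πℤ`. -/
def expT (θ : AddCircle (2 * Real.pi)) : ℂ := (Circle.periodic_exp.lift θ : Circle)

/-- The order parameter `R(Θ) = |(1/N) ∑_j e^{iθ_j}|`. -/
def R {N : ℕ} (Θ : Torus N) : ℝ := ‖(1 / (N : ℂ)) * ∑ j, expT (Θ j)‖

/-- The Kuramoto vector field `F_i(Θ) = ν_i + (κ/N) ∑_j sin(θ_j - θ_i)` on the torus, in the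
standard trivialization of the tangent bundle. -/
def F {N : ℕ} (κ : ℝ) (ν : Fin N → ℝ) (Θ : Torus N) : Fin N → ℝ :=
  fun i => ν i + κ / N * ∑ j, sinT (Θ j - Θ i)

/-- A curve in the torus is a (global) solution of the Kuramoto model `Θ' = F(Θ)` if it has a
differentiable lift `θ` to `ℝ^N` with `θ'(t) = F(Θ(t))` for all `t`. -/
def IsSolution {N : ℕ} (κ : ℝ) (ν : Fin N → ℝ) (Θ : ℝ → Torus N) : Prop :=
  ∃ θ : ℝ → Fin N → ℝ, (∀ t i, Θ t i = (θ t i : AddCircle (2 * Real.pi))) ∧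
    ∀ t, HasDerivAt θ (F κ ν (Θ t)) t

/-- The projection `ℝ^N → 𝕋^N`. -/
def proj {N : ℕ} (x : Fin N → ℝ) : Torus N := fun i => (x i : AddCircle (2 * Real.pi))

theorem sinT_coe (x : ℝ) : sinT (x : AddCircle (2 * Real.pi)) = Real.sin x := rfl

theorem expT_coe (x : ℝ) :
    expT (x : AddCircle (2 * Real.pi)) = Complex.exp (x * Complex.I) := rfl

theorem F_proj {N : ℕ} (κ : ℝ) (ν : Fin N → ℝ) (x : Fin N → ℝ) (i : Fin N) :
    F κ ν (proj x) i = ν i + κ / N * ∑ j, Real.sin (x j - x i) := rfl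

theorem norm_F_le {N : ℕ} (κ : ℝ) (ν : Fin N → ℝ) (x : Fin N → ℝ) :
    ‖F κ ν (proj x)‖ ≤ ‖ν‖ + |κ| := by
  rw [pi_norm_le_iff_of_nonneg (by positivity)]
  intro i
  have hN : (0 : ℝ) < N := by exact_mod_cast (Fin.pos i)
  rw [F_proj, Real.norm_eq_abs]
  refine (abs_add_le _ _).trans (add_le_add (norm_le_pi_norm ν i) ?_)
  rw [abs_mul, abs_div, abs_of_pos hN]
  have h : |∑ j, Real.sin (x j - x i)| ≤ N := by
    refine (Finset.abs_sum_le_sum_abs _ _).trans ?_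
    calc ∑ j, |Real.sin (x j - x i)| ≤ ∑ _j : Fin N, (1 : ℝ) :=
          Finset.sum_le_sum fun j _ => Real.abs_sin_le_one _
      _ = N := by simp
  calc |κ| / N * |∑ j, Real.sin (x j - x i)| ≤ |κ| / N * N := by gcongr
    _ = |κ| := by field_simp

theorem lipschitz_F {N : ℕ} (κ : ℝ) (ν : Fin N → ℝ) :
    LipschitzWith (2 * |κ|).toNNReal (fun x : Fin N → ℝ => F κ ν (proj x)) := by
  refine LipschitzWith.of_dist_le_mul fun x y => ?_
  rw [Real.coe_toNNReal _ (by positivity), dist_pi_le_iff (by positivity)]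
  intro i
  have hN : (0 : ℝ) < N := by exact_mod_cast (Fin.pos i)
  rw [F_proj, F_proj, Real.dist_eq, add_sub_add_left_eq_sub, ← mul_sub, ← Finset.sum_sub_distrib,
    abs_mul, abs_div, abs_of_pos hN]
  have h : |∑ j, (Real.sin (x j - x i) - Real.sin (y j - y i))| ≤ N * (2 * dist x y) := by
    refine (Finset.abs_sum_le_sum_abs _ _).trans ?_
    calc ∑ j, |Real.sin (x j - x i) - Real.sin (y j - y i)|
        ≤ ∑ _j : Fin N, (2 * dist x y) := by
          refine Finset.sum_le_sum fun j _ => ?_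
          have h1 : |Real.sin (x j - x i) - Real.sin (y j - y i)|
              ≤ |(x j - x i) - (y j - y i)| := Real.abs_sin_sub_sin_le _ _
          have h2 : |x j - y j| ≤ dist x y := dist_le_pi_dist x y j
          have h3 : |x i - y i| ≤ dist x y := dist_le_pi_dist x y i
          have h4 : |(x j - x i) - (y j - y i)| ≤ |x j - y j| + |x i - y i| := by
            rw [show (x j - x i) - (y j - y i) = (x j - y j) - (x i - y i) by ring]
            exact abs_sub _ _
          linarith
      _ = N * (2 * dist x y) := by simp
  calc |κ| / N * |∑ j, (Real.sin (x j - x i) - Real.sin (y j - y i))|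
      ≤ |κ| / N * (N * (2 * dist x y)) := by gcongr
    _ = 2 * |κ| * dist x y := by field_simp

/-- Global existence for an autonomous ODE with bounded Lipschitz right-hand side. -/
theorem exists_global {N : ℕ} {v : (Fin N → ℝ) → Fin N → ℝ} {K L : NNReal}
    (hK : LipschitzWith K v) (hL : ∀ x, ‖v x‖ ≤ L) (x : Fin N → ℝ) :
    ∃ γ : ℝ → Fin N → ℝ, γ 0 = x ∧ ∀ t, HasDerivAt γ (v (γ t)) t := by
  have hloc : ∀ T : ℝ, 0 < T → ∃ γ : ℝ → Fin N → ℝ, γ 0 = x ∧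
      ∀ t ∈ Set.Ioo (-T) T, HasDerivAt γ (v (γ t)) t := by
    intro T hT
    have hp : IsPicardLindelof (fun _ => v)
        (⟨0, by constructor <;> linarith⟩ : Set.Icc (-T) T) x (L * T.toNNReal) 0 L K := by
      refine IsPicardLindelof.of_time_independent (fun y _ => hL y) hK.lipschitzOnWith ?_
      simp [hT.le]
    obtain ⟨γ, h0, hγ⟩ := hp.exists_eq_forall_mem_Icc_hasDerivWithinAt₀
    exact ⟨γ, h0, fun t ht => (hγ t (Set.Ioo_subset_Icc_self ht)).hasDerivAt
      (Icc_mem_nhds ht.1 ht.2)⟩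
  choose g g0 hg using hloc
  have hpos : ∀ t : ℝ, 0 < |t| + 1 := fun t => by positivity
  have hagree : ∀ S T (hS : 0 < S) (hT : 0 < T), S ≤ T →
      ∀ t ∈ Set.Ioo (-S) S, g S hS t = g T hT t := by
    intro S T hS hT hST
    refine ODE_solution_unique_of_mem_Ioo (v := fun _ => v) (s := fun _ => Set.univ) (t₀ := 0)
      (fun t _ => hK.lipschitzOnWith) ⟨by linarith, hS⟩ (fun t ht => ⟨hg S hS t ht, trivial⟩)
      (fun t ht => ⟨hg T hT t ⟨by linarith [ht.1], by linarith [ht.2]⟩, trivial⟩) ?_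
    rw [g0, g0]
  refine ⟨fun t => g (|t| + 1) (hpos t) t, g0 _ _, fun t => ?_⟩
  have hT : 0 < |t| + 2 := by positivity
  have heq : (fun s => g (|s| + 1) (hpos s) s) =ᶠ[nhds t] g (|t| + 2) hT := by
    have hev : ∀ᶠ s in nhds t, |s| < |t| + 1 :=
      continuous_abs.continuousAt.eventually_lt continuousAt_const (by linarith)
    filter_upwards [hev] with s hs
    exact hagree _ _ _ _ (by linarith) s (abs_lt.mp (by linarith))
  have hd := hg (|t| + 2) hT t (abs_lt.mp (by linarith))
  rw [← heq.eq_of_nhds] at hd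
  exact hd.congr_of_eventuallyEq heq

/-- Every initial datum on the torus has exactly one global solution of the Kuramoto model. -/
theorem existsUnique_solution {N : ℕ} (κ : ℝ) (ν : Fin N → ℝ) (Θ₀ : Torus N) :
    ∃! Θ : ℝ → Torus N, Θ 0 = Θ₀ ∧ IsSolution κ ν Θ := by
  obtain ⟨x, hx⟩ : ∃ x : Fin N → ℝ, proj x = Θ₀ := by
    choose x hx using fun i => QuotientAddGroup.mk_surjective (Θ₀ i)
    exact ⟨x, funext hx⟩
  obtain ⟨γ, h0, hγ⟩ := exists_global (L := ⟨‖ν‖ + |κ|, by positivity⟩) (lipschitz_F κ ν)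
    (norm_F_le κ ν) x
  refine ⟨fun t => proj (γ t), ⟨by simp only [h0, hx], γ, fun _ _ => rfl, hγ⟩, ?_⟩
  rintro Θ ⟨hΘ0, θ, hθ, hd⟩
  have hθ' : ∀ t, Θ t = proj (θ t) := fun t => funext (hθ t)
  have hshift : ∀ t, proj (θ t + (x - θ 0)) = Θ t := by
    intro t
    have h1 : proj (θ 0) = proj x := by rw [← hθ' 0, hΘ0, hx]
    funext i
    have h2 : (θ 0 i : AddCircle (2 * Real.pi)) = (x i : AddCircle (2 * Real.pi)) :=
      congrFun h1 i
    rw [hθ' t]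
    simp only [proj, Pi.add_apply, Pi.sub_apply, AddCircle.coe_add, AddCircle.coe_sub, h2,
      sub_self, add_zero]
  have hu : (fun t => θ t + (x - θ 0)) = γ := by
    refine ODE_solution_unique_univ (v := fun _ y => F κ ν (proj y)) (s := fun _ => Set.univ)
      (t₀ := 0) (fun t => (lipschitz_F κ ν).lipschitzOnWith) (fun t => ⟨?_, trivial⟩)
      (fun t => ⟨hγ t, trivial⟩) ?_
    · rw [hshift t]
      exact (hd t).add_const _
    · simp [h0]
  funext t
  rw [← hshift t, ← hu]

/-- The Kuramoto flow on the torus: `flow κ ν t Θ₀ = Φ_t(Θ₀)` is the value at time `t` of the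
unique solution with initial datum `Θ₀`. -/
def flow {N : ℕ} (κ : ℝ) (ν : Fin N → ℝ) (t : ℝ) (Θ₀ : Torus N) : Torus N :=
  (existsUnique_solution κ ν Θ₀).choose t

theorem flow_zero {N : ℕ} (κ : ℝ) (ν : Fin N → ℝ) (Θ₀ : Torus N) : flow κ ν 0 Θ₀ = Θ₀ :=
  (existsUnique_solution κ ν Θ₀).choose_spec.1.1

theorem isSolution_flow {N : ℕ} (κ : ℝ) (ν : Fin N → ℝ) (Θ₀ : Torus N) :
    IsSolution κ ν (fun t => flow κ ν t Θ₀) :=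
  (existsUnique_solution κ ν Θ₀).choose_spec.1.2

end Kuramoto

end

/-!
The divergence of the Kuramoto vector field is `κ (1 - N R²)` (`sum_jacobian_diag`), so on each of
the two sets in question it is bounded below by a positive constant `c`. These sets are forward
invariant, and the flow strictly expands the volume of anything on which the divergence is
positive; as the torus has finite volume, the sets are null
(`volume_eq_zero_of_forwardInvariant`).

One short time step suffices, so Liouville's formula and the smooth dependence of the flow on the
initial datum are not needed. On the universal cover `ℝ^N`, the time-`h` map is
`id + h F` up to an error whose Lipschitz constant is `O(h²)`
(`exists_norm_euler_remainder_sub_le`). Being Lipschitz, it is differentiable almost everywhere by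
Rademacher's theorem, and where it is differentiable its Jacobian determinant is at least
`1 + h c / 2 > 1` if `h` is small (`exists_step_le_det`). The area formula turns this into an
expansion of volume.

To pass from the cover to the torus, volumes of subsets of the torus are computed in the cube
`(0, 2π]^N`. The time-`h` map commutes with the deck transformations, hence carries the cube to
another fundamental domain, and a periodic set has the same volume in both
(`isAddFundamentalDomain_image_cube`).

The sets are Borel because the points whose orbit leaves an open set during `[0, n]` form the
projection of a compact set (`measurableSet_forall_flow_mem`).
-/

open MeasureTheory

namespace Kuramoto

/-! ### The flow on the universal cover -/

section Lift

variable {N : ℕ} (κ : ℝ) (ν : Fin N → ℝ)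

/-- The Kuramoto flow on the universal cover `ℝ^N` of the torus. -/
noncomputable def liftFlow (t : ℝ) (x : Fin N → ℝ) : Fin N → ℝ :=
  (exists_global (L := ⟨‖ν‖ + |κ|, by positivity⟩) (lipschitz_F κ ν) (norm_F_le κ ν) x).choose t

theorem liftFlow_zero (x : Fin N → ℝ) : liftFlow κ ν 0 x = x :=
  (exists_global (L := ⟨‖ν‖ + |κ|, by positivity⟩) (lipschitz_F κ ν)
    (norm_F_le κ ν) x).choose_spec.1

theorem hasDerivAt_liftFlow (t : ℝ) (x : Fin N → ℝ) :
    HasDerivAt (fun s => liftFlow κ ν s x) (F κ ν (proj (liftFlow κ ν t x))) t :=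
  (exists_global (L := ⟨‖ν‖ + |κ|, by positivity⟩) (lipschitz_F κ ν)
    (norm_F_le κ ν) x).choose_spec.2 t

variable {κ ν}

/-- Uniqueness: every global solution of the lifted equation is an orbit of the lifted flow. -/
theorem eq_liftFlow {γ : ℝ → Fin N → ℝ} (hγ : ∀ t, HasDerivAt γ (F κ ν (proj (γ t))) t) (t : ℝ) :
    γ t = liftFlow κ ν t (γ 0) := by
  refine congrFun (ODE_solution_unique_univ (v := fun _ y => F κ ν (proj y))
    (s := fun _ => Set.univ) (t₀ := 0) (g := fun t => liftFlow κ ν t (γ 0))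
    (fun t => (lipschitz_F κ ν).lipschitzOnWith)
    (fun t => ⟨hγ t, trivial⟩) (fun t => ⟨hasDerivAt_liftFlow κ ν t _, trivial⟩) ?_) t
  simp [liftFlow_zero]

variable (κ ν)

theorem liftFlow_add (s t : ℝ) (x : Fin N → ℝ) :
    liftFlow κ ν (s + t) x = liftFlow κ ν s (liftFlow κ ν t x) := by
  have h := eq_liftFlow (κ := κ) (ν := ν) (γ := fun s => liftFlow κ ν (s + t) x)
    (fun s => (hasDerivAt_liftFlow κ ν (s + t) x).comp_add_const s t) s
  simpa using h

theorem liftFlow_injective (t : ℝ) : Function.Injective (liftFlow κ ν t) :=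
  Function.LeftInverse.injective (g := liftFlow κ ν (-t)) fun x => by
    rw [← liftFlow_add, neg_add_cancel, liftFlow_zero]

theorem proj_add_of_proj_eq_zero {p : Fin N → ℝ} (hp : proj p = 0) (x : Fin N → ℝ) :
    proj (x + p) = proj x := by
  funext i
  have h : (p i : AddCircle (2 * Real.pi)) = 0 := congrFun hp i
  simp [proj, h]

/-- The lifted flow commutes with the deck transformations. -/
theorem liftFlow_add_period {p : Fin N → ℝ} (hp : proj p = 0) (t : ℝ) (x : Fin N → ℝ) :
    liftFlow κ ν t (x + p) = liftFlow κ ν t x + p := by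
  have h := eq_liftFlow (κ := κ) (ν := ν) (γ := fun s => liftFlow κ ν s x + p) (fun s => by
    rw [proj_add_of_proj_eq_zero hp]
    exact (hasDerivAt_liftFlow κ ν s x).add_const _) t
  simpa [liftFlow_zero] using h.symm

theorem flow_proj (t : ℝ) (x : Fin N → ℝ) :
    flow κ ν t (proj x) = proj (liftFlow κ ν t x) := by
  have h := (existsUnique_solution κ ν (proj x)).unique
    (y₁ := fun t => flow κ ν t (proj x)) (y₂ := fun t => proj (liftFlow κ ν t x))
    ⟨flow_zero κ ν _, isSolution_flow κ ν _⟩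
    ⟨by simp only [liftFlow_zero], fun t => liftFlow κ ν t x, fun _ _ => rfl,
      fun t => hasDerivAt_liftFlow κ ν t x⟩
  exact congrFun h t

theorem proj_surjective : Function.Surjective (proj (N := N)) := fun Θ => by
  choose x hx using fun i => QuotientAddGroup.mk_surjective (Θ i)
  exact ⟨x, funext hx⟩

theorem flow_add (s t : ℝ) (Θ : Torus N) : flow κ ν (s + t) Θ = flow κ ν s (flow κ ν t Θ) := by
  obtain ⟨x, rfl⟩ := proj_surjective Θ
  simp only [flow_proj, liftFlow_add]

/-- Grönwall's inequality for the lifted flow. -/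
theorem norm_liftFlow_sub_le {t : ℝ} (ht : 0 ≤ t) (x y : Fin N → ℝ) :
    ‖liftFlow κ ν t x - liftFlow κ ν t y‖ ≤ ‖x - y‖ * Real.exp (2 * |κ| * t) := by
  have h := dist_le_of_trajectories_ODE (v := fun _ y => F κ ν (proj y))
    (f := fun s => liftFlow κ ν s x) (g := fun s => liftFlow κ ν s y) (a := 0) (b := t)
    (δ := ‖x - y‖) (fun _ => lipschitz_F κ ν)
    (fun s _ => (hasDerivAt_liftFlow κ ν s x).continuousAt.continuousWithinAt)
    (fun s _ => (hasDerivAt_liftFlow κ ν s x).hasDerivWithinAt)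
    (fun s _ => (hasDerivAt_liftFlow κ ν s y).continuousAt.continuousWithinAt)
    (fun s _ => (hasDerivAt_liftFlow κ ν s y).hasDerivWithinAt)
    (by simp [liftFlow_zero, dist_eq_norm]) t ⟨ht, le_rfl⟩
  rw [Real.coe_toNNReal _ (by positivity), sub_zero, dist_eq_norm] at h
  exact h

theorem norm_liftFlow_sub_self_le {t : ℝ} (ht : 0 ≤ t) (x : Fin N → ℝ) :
    ‖liftFlow κ ν t x - x‖ ≤ (‖ν‖ + |κ|) * t := by
  have h := norm_image_sub_le_of_norm_deriv_le_segment' (f := fun s => liftFlow κ ν s x) (a := 0)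
    (b := t) (fun s _ => (hasDerivAt_liftFlow κ ν s x).hasDerivWithinAt)
    (fun s _ => norm_F_le κ ν _) t ⟨ht, le_rfl⟩
  simpa [liftFlow_zero] using h

theorem lipschitzWith_liftFlow {t : ℝ} (ht : 0 ≤ t) :
    LipschitzWith (Real.exp (2 * |κ| * t)).toNNReal (liftFlow κ ν t) :=
  LipschitzWith.of_dist_le_mul fun x y => by
    rw [Real.coe_toNNReal _ (Real.exp_pos _).le, dist_eq_norm, dist_eq_norm, mul_comm]
    exact norm_liftFlow_sub_le κ ν ht x y

/-- Joint continuity of the lifted flow for nonnegative times. -/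
theorem continuous_liftFlow :
    Continuous fun p : Set.Ici (0 : ℝ) × (Fin N → ℝ) => liftFlow κ ν p.1 p.2 := by
  refine continuous_iff_continuousAt.2 fun ⟨t, x⟩ => ?_
  rw [ContinuousAt, tendsto_iff_norm_sub_tendsto_zero]
  have hc : Continuous fun p : Set.Ici (0 : ℝ) × (Fin N → ℝ) =>
      ‖p.2 - x‖ * Real.exp (2 * |κ| * p.1) +
        ‖liftFlow κ ν p.1 x - liftFlow κ ν t x‖ := by
    have : Continuous fun s => liftFlow κ ν s x :=
      continuous_iff_continuousAt.2 fun s => (hasDerivAt_liftFlow κ ν s x).continuousAt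
    fun_prop
  have h0 := hc.tendsto (t, x)
  simp only [sub_self, norm_zero, zero_mul, add_zero] at h0
  refine squeeze_zero (fun _ => norm_nonneg _) (fun p => ?_) h0
  refine (norm_sub_le_norm_sub_add_norm_sub _ (liftFlow κ ν p.1 x) _).trans ?_
  gcongr
  exact norm_liftFlow_sub_le κ ν p.1.2 _ _

end Lift

/-! ### The determinant near the identity -/

section Det

variable {N : ℕ}

theorem det_eq_det_of (A : (Fin N → ℝ) →L[ℝ] (Fin N → ℝ)) :
    A.det = (Matrix.of fun i j => A (Pi.single j 1) i).det := by
  rw [ContinuousLinearMap.det, ← LinearMap.det_toMatrix']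
  congr 1

/-- First-order expansion of the determinant at the identity, with a remainder that is uniform in
the direction. -/
theorem exists_forall_one_add_trace_le_det {ε : ℝ} (hε : 0 < ε) :
    ∃ δ > 0, ∀ E : (Fin N → ℝ) →L[ℝ] (Fin N → ℝ), ‖E‖ ≤ δ →
      1 + ∑ i, E (Pi.single i 1) i - ε * ‖E‖ ≤ (1 + E).det := by
  set f : ((Fin N → ℝ) →L[ℝ] (Fin N → ℝ)) → ℝ := fun E => (1 + E).det with hf
  -- By the Leibniz formula the determinant is a polynomial in the entries.
  have hd : DifferentiableAt ℝ f 0 := by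
    have : f = fun E => ∑ σ : Equiv.Perm (Fin N), (Equiv.Perm.sign σ : ℝ) *
        ∏ i, ((Pi.single i 1 : Fin N → ℝ) (σ i) + E (Pi.single i 1) (σ i)) := by
      funext E
      rw [hf]
      simp only [det_eq_det_of, Matrix.det_apply']
      rfl
    rw [this]
    have hl : ∀ i k : Fin N, DifferentiableAt ℝ
        (fun E : (Fin N → ℝ) →L[ℝ] (Fin N → ℝ) => E (Pi.single i 1) k) 0 := fun i k => by
      have h : DifferentiableAt ℝ
          (fun E : (Fin N → ℝ) →L[ℝ] (Fin N → ℝ) => E (Pi.single i 1)) 0 := by fun_prop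
      exact differentiableAt_pi.1 h k
    refine DifferentiableAt.fun_sum fun σ _ => DifferentiableAt.const_mul ?_ _
    have h : ∀ i ∈ Finset.univ, DifferentiableAt ℝ
        (fun E : (Fin N → ℝ) →L[ℝ] (Fin N → ℝ) =>
          (Pi.single i 1 : Fin N → ℝ) (σ i) + E (Pi.single i 1) (σ i)) 0 :=
      fun i _ => (hl i (σ i)).const_add _
    exact (HasFDerivAt.finsetProd fun i hi => (h i hi).hasFDerivAt).differentiableAt
  have htr : ∀ E, fderiv ℝ f 0 E = ∑ i, E (Pi.single i 1) i := by
    intro E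
    -- Along the line through `E` the determinant is the polynomial `1 + (tr E) r + O(r²)`.
    set M : Matrix (Fin N) (Fin N) ℝ := Matrix.of fun i j => E (Pi.single j 1) i with hM
    have h1 : HasDerivAt (fun r : ℝ => f (r • E)) (fderiv ℝ f 0 E) 0 := by
      have h2 : HasDerivAt (fun r : ℝ => r • E) E 0 := by
        simpa using (hasDerivAt_id (0 : ℝ)).smul_const E
      have h3 : HasFDerivAt f (fderiv ℝ f 0) ((0 : ℝ) • E) := by
        rw [zero_smul]; exact hd.hasFDerivAt
      exact h3.comp_hasDerivAt 0 h2
    set P := (Matrix.det (1 + (Polynomial.X : Polynomial ℝ) • M.map Polynomial.C)).divX.divX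
    have h4 : (fun r : ℝ => f (r • E)) = fun r => 1 + Matrix.trace M * r + P.eval r * r ^ 2 := by
      funext r
      rw [← Matrix.det_one_add_smul, hf]
      simp only [det_eq_det_of]
      congr 1
      ext i j
      simp [hM, Matrix.one_apply, Pi.single_apply]
    have h5 : HasDerivAt (fun r : ℝ => 1 + Matrix.trace M * r + P.eval r * r ^ 2)
        (Matrix.trace M) 0 := by
      have := (((hasDerivAt_id (0 : ℝ)).const_mul (Matrix.trace M)).const_add 1).add
        ((P.hasDerivAt 0).mul ((hasDerivAt_id (0 : ℝ)).pow 2))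
      convert! this using 1
      simp
    rw [h4] at h1
    rw [h1.unique h5]
    rfl
  have hlo := (hasFDerivAt_iff_isLittleO_nhds_zero.1 hd.hasFDerivAt).def hε
  obtain ⟨δ, hδ, h⟩ := Metric.eventually_nhds_iff.1 hlo
  refine ⟨δ / 2, by positivity, fun E hE => ?_⟩
  have h1 := h (y := E) (by rw [dist_zero_right]; linarith)
  rw [zero_add, htr, Real.norm_eq_abs] at h1
  have h2 : f 0 = 1 := by
    simp only [hf, add_zero]
    exact LinearMap.det_id
  rw [h2] at h1
  have := (abs_le.1 h1).1
  linarith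

end Det

/-! ### The derivative and the divergence of the vector field -/

section Divergence

variable {N : ℕ} (κ : ℝ) (ν : Fin N → ℝ)

/-- The Jacobian of the lifted vector field. -/
noncomputable def jacobian (x : Fin N → ℝ) : (Fin N → ℝ) →L[ℝ] (Fin N → ℝ) :=
  ContinuousLinearMap.pi fun i => (κ / N) • ∑ j, Real.cos (x j - x i) •
    (ContinuousLinearMap.proj (R := ℝ) (φ := fun _ : Fin N => ℝ) j -
      ContinuousLinearMap.proj (R := ℝ) (φ := fun _ : Fin N => ℝ) i)

theorem hasFDerivAt_F (x : Fin N → ℝ) :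
    HasFDerivAt (fun y => F κ ν (proj y)) (jacobian κ x) x := by
  rw [hasFDerivAt_pi']
  intro i
  have hp : ∀ k : Fin N, HasFDerivAt (fun y : Fin N → ℝ => y k)
      (ContinuousLinearMap.proj (R := ℝ) (φ := fun _ : Fin N => ℝ) k) x := fun k =>
    (ContinuousLinearMap.proj (R := ℝ) (φ := fun _ : Fin N => ℝ) k).hasFDerivAt
  have h : HasFDerivAt (fun y : Fin N → ℝ => ν i + κ / N * ∑ j, Real.sin (y j - y i))
      ((κ / N) • ∑ j, Real.cos (x j - x i) •
    (ContinuousLinearMap.proj (R := ℝ) (φ := fun _ : Fin N => ℝ) j -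
      ContinuousLinearMap.proj (R := ℝ) (φ := fun _ : Fin N => ℝ) i)) x :=
    ((HasFDerivAt.fun_sum fun j _ => ((hp j).fun_sub (hp i)).sin).const_mul (κ / N)).const_add (ν i)
  exact h

theorem norm_jacobian_le (x : Fin N → ℝ) : ‖jacobian κ x‖ ≤ 2 * |κ| := by
  have h := (hasFDerivAt_F κ 0 x).le_of_lipschitz (lipschitz_F κ 0)
  rwa [Real.coe_toNNReal _ (by positivity)] at h

/-- Expanding `|∑ e^{iθ_j}|²` expresses the order parameter through the phase differences. -/
theorem sq_R_proj (x : Fin N → ℝ) :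
    (N : ℝ) ^ 2 * R (proj x) ^ 2 = ∑ i, ∑ j, Real.cos (x j - x i) := by
  rcases Nat.eq_zero_or_pos N with rfl | hN
  · simp
  have hN' : (N : ℝ) ≠ 0 := by positivity
  have h1 : R (proj x) = (N : ℝ)⁻¹ * ‖∑ j, Complex.exp (x j * Complex.I)‖ := by
    simp [R, proj, expT_coe]
  have hre : (∑ j, Complex.exp (x j * Complex.I)).re = ∑ j, Real.cos (x j) := by
    simp [Complex.exp_ofReal_mul_I_re]
  have him : (∑ j, Complex.exp (x j * Complex.I)).im = ∑ j, Real.sin (x j) := by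
    simp [Complex.exp_ofReal_mul_I_im]
  rw [h1, mul_pow, ← mul_assoc, ← mul_pow, mul_inv_cancel₀ hN', one_pow, one_mul,
    ← Complex.normSq_eq_norm_sq, Complex.normSq_apply, hre, him, Finset.sum_mul_sum,
    Finset.sum_mul_sum, ← Finset.sum_add_distrib]
  refine Finset.sum_congr rfl fun i _ => ?_
  rw [← Finset.sum_add_distrib]
  refine Finset.sum_congr rfl fun j _ => ?_
  rw [Real.cos_sub]
  ring

/-- The divergence of the Kuramoto vector field is `κ (1 - N R²)`. -/
theorem sum_jacobian_diag (hN : 1 ≤ N) (x : Fin N → ℝ) :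
    ∑ i, jacobian κ x (Pi.single i 1) i = κ * (1 - N * R (proj x) ^ 2) := by
  have hN' : (N : ℝ) ≠ 0 := by positivity
  have h1 : ∀ i, jacobian κ x (Pi.single i 1) i = κ / N * (1 - ∑ j, Real.cos (x j - x i)) := by
    intro i
    simp [jacobian, mul_sub, Finset.sum_sub_distrib, Pi.single_apply]
  simp only [h1]
  rw [← Finset.mul_sum, Finset.sum_sub_distrib, ← sq_R_proj]
  simp
  field_simp

end Divergence

/-! ### Expansion of volume under a short time step -/

section Step

variable {N : ℕ} (κ : ℝ) (ν : Fin N → ℝ)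

/-- A second-difference estimate for the sine, from
`sin p - sin q = 2 sin ((p - q) / 2) cos ((p + q) / 2)`. -/
theorem abs_sin_sub_sin_sub_le (p q p' q' : ℝ) :
    |Real.sin p - Real.sin q - (Real.sin p' - Real.sin q')| ≤
      |(p - q) - (p' - q')| + |p - q| * |(p + q) / 2 - (p' + q') / 2| := by
  rw [Real.sin_sub_sin, Real.sin_sub_sin]
  set a := (p - q) / 2 with ha
  set b := (p' - q') / 2 with hb
  set m := (p + q) / 2
  set n := (p' + q') / 2
  have h1 : |Real.sin a - Real.sin b| ≤ |a - b| := Real.abs_sin_sub_sin_le _ _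
  have h2 : |Real.cos m - Real.cos n| ≤ |m - n| := Real.abs_cos_sub_cos_le _ _
  have h3 : |Real.sin a| ≤ |a| := Real.abs_sin_le_abs
  have h4 : |Real.cos n| ≤ 1 := Real.abs_cos_le_one n
  have e1 : |p - q - (p' - q')| = 2 * |a - b| := by
    rw [show p - q - (p' - q') = 2 * (a - b) by rw [ha, hb]; ring, abs_mul, abs_two]
  have e2 : |p - q| = 2 * |a| := by
    rw [show p - q = 2 * a by rw [ha]; ring, abs_mul, abs_two]
  rw [e1, e2]
  calc |2 * Real.sin a * Real.cos m - 2 * Real.sin b * Real.cos n|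
      = |2 * ((Real.sin a - Real.sin b) * Real.cos n) +
          2 * (Real.sin a * (Real.cos m - Real.cos n))| := by congr 1; ring
    _ ≤ |2 * ((Real.sin a - Real.sin b) * Real.cos n)| +
          |2 * (Real.sin a * (Real.cos m - Real.cos n))| := abs_add_le _ _
    _ = 2 * (|Real.sin a - Real.sin b| * |Real.cos n|) +
          2 * (|Real.sin a| * |Real.cos m - Real.cos n|) := by simp [abs_mul]
    _ ≤ 2 * (|a - b| * 1) + 2 * (|a| * |m - n|) := by gcongr
    _ = 2 * |a - b| + 2 * |a| * |m - n| := by ring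

/-- A second-difference estimate for the vector field: it plays the role of a Lipschitz bound for
the Jacobian. -/
theorem norm_F_sub_sub_le (a b a' b' : Fin N → ℝ) :
    ‖F κ ν (proj a') - F κ ν (proj b') - (F κ ν (proj a) - F κ ν (proj b))‖ ≤
      2 * |κ| * (‖a' - b' - (a - b)‖ + ‖a' - b'‖ * (‖a' - a‖ + ‖b' - b‖)) := by
  rw [pi_norm_le_iff_of_nonneg (by positivity)]
  intro i
  have hN : (0 : ℝ) < N := by exact_mod_cast (Fin.pos i)
  simp only [Pi.sub_apply, F_proj]
  set B := ‖a' - b' - (a - b)‖ + ‖a' - b'‖ * (‖a' - a‖ + ‖b' - b‖)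
  have hterm : ∀ j, |Real.sin (a' j - a' i) - Real.sin (b' j - b' i) -
      (Real.sin (a j - a i) - Real.sin (b j - b i))| ≤ 2 * B := by
    intro j
    have hn : ∀ (z : Fin N → ℝ), |z j - z i| ≤ 2 * ‖z‖ := fun z => by
      have h1 := norm_le_pi_norm z i
      have h2 := norm_le_pi_norm z j
      rw [Real.norm_eq_abs] at h1 h2
      linarith [abs_sub (z j) (z i)]
    refine (abs_sin_sub_sin_sub_le _ _ _ _).trans ?_
    have h1 : |a' j - a' i - (b' j - b' i) - (a j - a i - (b j - b i))| ≤
        2 * ‖a' - b' - (a - b)‖ := by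
      convert hn (a' - b' - (a - b)) using 2
      simp only [Pi.sub_apply]; ring
    have h2 : |a' j - a' i - (b' j - b' i)| ≤ 2 * ‖a' - b'‖ := by
      convert hn (a' - b') using 2
      simp only [Pi.sub_apply]; ring
    have h3 : |(a' j - a' i + (b' j - b' i)) / 2 - (a j - a i + (b j - b i)) / 2| ≤
        ‖a' - a‖ + ‖b' - b‖ := by
      have h4 := hn (a' - a)
      have h5 := hn (b' - b)
      simp only [Pi.sub_apply] at h4 h5
      rw [abs_le] at *
      constructor <;> linarith [h4.1, h4.2, h5.1, h5.2]
    calc _ ≤ 2 * ‖a' - b' - (a - b)‖ + 2 * ‖a' - b'‖ * (‖a' - a‖ + ‖b' - b‖) := by gcongr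
      _ = 2 * B := by ring
  calc ‖ν i + κ / N * ∑ j, Real.sin (a' j - a' i) - (ν i + κ / N * ∑ j, Real.sin (b' j - b' i)) -
        (ν i + κ / N * ∑ j, Real.sin (a j - a i) - (ν i + κ / N * ∑ j, Real.sin (b j - b i)))‖
      = |κ| / N * |∑ j, (Real.sin (a' j - a' i) - Real.sin (b' j - b' i) -
          (Real.sin (a j - a i) - Real.sin (b j - b i)))| := by
        rw [Real.norm_eq_abs, ← abs_of_pos hN, ← abs_div, ← abs_mul, abs_of_pos hN]
        congr 1
        simp only [Finset.sum_sub_distrib]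
        ring
    _ ≤ |κ| / N * ∑ _j : Fin N, 2 * B := by
        gcongr
        exact (Finset.abs_sum_le_sum_abs _ _).trans (Finset.sum_le_sum fun j _ => hterm j)
    _ = 2 * |κ| * B := by
        simp
        field_simp

/-- The remainder `Φ_h - id - h F` of the Euler approximation has Lipschitz constant `O(h²)`. -/
theorem exists_norm_euler_remainder_sub_le :
    ∃ C : ℝ, 0 ≤ C ∧ ∀ h : ℝ, 0 ≤ h → h ≤ 1 → ∀ x y : Fin N → ℝ,
      ‖(liftFlow κ ν h x - x - h • F κ ν (proj x)) - (liftFlow κ ν h y - y - h • F κ ν (proj y))‖ ≤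
        C * h ^ 2 * ‖x - y‖ := by
  set D := Real.exp (2 * |κ|)
  set M := ‖ν‖ + |κ| with hM
  refine ⟨2 * |κ| * (2 * |κ| * D + D * (2 * M)), by positivity, fun h h0 h1 x y => ?_⟩
  have hexp : ∀ s ∈ Set.Icc 0 h, ‖liftFlow κ ν s x - liftFlow κ ν s y‖ ≤ D * ‖x - y‖ := by
    intro s hs
    refine (norm_liftFlow_sub_le κ ν hs.1 x y).trans ?_
    rw [mul_comm]
    have : Real.exp (2 * |κ| * s) ≤ D := Real.exp_le_exp.2 <|
      mul_le_of_le_one_right (by positivity) (hs.2.trans h1)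
    gcongr
  have hdisp : ∀ s ∈ Set.Icc 0 h,
      ‖liftFlow κ ν s x - liftFlow κ ν s y - (x - y)‖ ≤ 2 * |κ| * D * ‖x - y‖ * h := by
    intro s hs
    have := norm_image_sub_le_of_norm_deriv_le_segment'
      (f := fun s => liftFlow κ ν s x - liftFlow κ ν s y) (a := 0) (b := h)
      (C := 2 * |κ| * D * ‖x - y‖)
      (fun s _ => ((hasDerivAt_liftFlow κ ν s x).sub
        (hasDerivAt_liftFlow κ ν s y)).hasDerivWithinAt)
      (fun s hs => ?_) s hs
    · simp only [liftFlow_zero, sub_zero] at this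
      refine this.trans ?_
      have := hs.2
      gcongr
    · refine ((lipschitz_F κ ν).norm_sub_le _ _).trans ?_
      rw [Real.coe_toNNReal _ (by positivity), mul_assoc (2 * |κ|)]
      have := hexp s (Set.Ico_subset_Icc_self hs)
      gcongr
  have key := norm_image_sub_le_of_norm_deriv_le_segment'
    (f := fun s => (liftFlow κ ν s x - liftFlow κ ν s y) - s • (F κ ν (proj x) - F κ ν (proj y)))
    (f' := fun s => (F κ ν (proj (liftFlow κ ν s x)) - F κ ν (proj (liftFlow κ ν s y))) -
      (F κ ν (proj x) - F κ ν (proj y)))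
    (a := 0) (b := h) (C := 2 * |κ| * (2 * |κ| * D + D * (2 * M)) * h * ‖x - y‖)
    (fun s _ => by
      have h2 := (hasDerivAt_id s).smul_const (F κ ν (proj x) - F κ ν (proj y))
      rw [one_smul] at h2
      exact (((hasDerivAt_liftFlow κ ν s x).sub
        (hasDerivAt_liftFlow κ ν s y)).sub h2).hasDerivWithinAt)
    (fun s hs => by
      have hs' := Set.Ico_subset_Icc_self hs
      refine (norm_F_sub_sub_le κ ν x y _ _).trans ?_
      have e1 := hexp s hs'
      have e2 := hdisp s hs'
      have e3 : ‖liftFlow κ ν s x - x‖ ≤ M * h :=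
        (norm_liftFlow_sub_self_le κ ν hs.1 x).trans (by gcongr; exact hs.2.le)
      have e4 : ‖liftFlow κ ν s y - y‖ ≤ M * h :=
        (norm_liftFlow_sub_self_le κ ν hs.1 y).trans (by gcongr; exact hs.2.le)
      calc _ ≤ 2 * |κ| * (2 * |κ| * D * ‖x - y‖ * h + D * ‖x - y‖ * (M * h + M * h)) := by gcongr
        _ = _ := by ring) h ⟨h0, le_rfl⟩
  simp only [liftFlow_zero, zero_smul, sub_zero] at key
  calc _ = ‖liftFlow κ ν h x - liftFlow κ ν h y - h • (F κ ν (proj x) - F κ ν (proj y)) -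
        (x - y)‖ := by
        congr 1
        rw [smul_sub]
        abel
    _ ≤ _ := key
    _ = _ := by ring

/-- Where the divergence is at least `c > 0`, the time-`h` map of the lifted flow, for `h` small
enough, has Jacobian determinant at least `1 + hc/2`. The step `h` does not depend on the point. -/
theorem exists_step_le_det (hN : 1 ≤ N) {c : ℝ} (hc : 0 < c) :
    ∃ h : ℝ, 0 < h ∧ ∀ (x : Fin N → ℝ) (A : (Fin N → ℝ) →L[ℝ] (Fin N → ℝ)),
      c ≤ κ * (1 - N * R (proj x) ^ 2) → HasFDerivAt (liftFlow κ ν h) A x →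
        1 + h * (c / 2) ≤ A.det := by
  obtain ⟨C, hC, hg⟩ := exists_norm_euler_remainder_sub_le κ ν
  set L := 2 * |κ| + C with hL
  have hL0 : 0 ≤ L := by positivity
  obtain ⟨δ, hδ, hdet⟩ := exists_forall_one_add_trace_le_det (N := N)
    (ε := c / (4 * (L + 1))) (by positivity)
  -- Both the remainder of the determinant and the trace of the Euler remainder cost at most
  -- `h c / 4`, out of a gain of `h c`.
  obtain ⟨h, h0, h1, h2, h3⟩ : ∃ h : ℝ, 0 < h ∧ h ≤ 1 ∧ h * (L + 1) ≤ δ ∧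
      N * (C * h) ≤ c / 4 := by
    refine ⟨min 1 (min (δ / (L + 1)) (c / (4 * (N * C + 1)))), by positivity, min_le_left _ _,
      ?_, ?_⟩
    · rw [← le_div_iff₀ (by positivity)]
      exact (min_le_right _ _).trans (min_le_left _ _)
    · set h := min 1 (min (δ / (L + 1)) (c / (4 * (N * C + 1)))) with hh
      have hle : h ≤ c / (4 * (N * C + 1)) := (min_le_right _ _).trans (min_le_right _ _)
      have hpos : 0 < h := by positivity
      rw [le_div_iff₀ (by positivity)] at hle
      nlinarith
  refine ⟨h, h0, fun x A hx hA => ?_⟩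
  set J := jacobian κ x
  set B := A - ContinuousLinearMap.id ℝ (Fin N → ℝ) - h • J with hB
  have hB' : HasFDerivAt (fun y => liftFlow κ ν h y - y - h • F κ ν (proj y)) B x :=
    (hA.sub (hasFDerivAt_id x)).sub ((hasFDerivAt_F κ ν x).const_smul h)
  have hBn : ‖B‖ ≤ C * h ^ 2 :=
    hB'.le_of_lip' (by positivity) (Filter.Eventually.of_forall fun y => hg h h0.le h1 y x)
  have hA' : A = 1 + (h • J + B) := by
    rw [hB]
    ext1 v
    simp
  have hEn : ‖h • J + B‖ ≤ h * L := by
    refine (norm_add_le _ _).trans ?_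
    rw [norm_smul, Real.norm_of_nonneg h0.le, hL]
    have := norm_jacobian_le κ x
    have h4 : C * h ^ 2 ≤ h * C := by nlinarith [mul_nonneg hC h0.le]
    have h5 : h * ‖J‖ ≤ h * (2 * |κ|) := by gcongr
    linarith
  have htrB : -(N * (C * h ^ 2)) ≤ ∑ i, B (Pi.single i 1) i := by
    have : ∀ i : Fin N, -(C * h ^ 2) ≤ B (Pi.single i 1) i := fun i => by
      have h4 := (norm_le_pi_norm (B (Pi.single i 1)) i).trans (B.le_opNorm _)
      rw [Pi.norm_single, norm_one, mul_one, Real.norm_eq_abs] at h4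
      exact (abs_le.1 (h4.trans hBn)).1
    simpa using Finset.sum_le_sum fun i (_ : i ∈ Finset.univ) => this i
  have htr : ∑ i, (h • J + B) (Pi.single i 1) i =
      h * (κ * (1 - N * R (proj x) ^ 2)) + ∑ i, B (Pi.single i 1) i := by
    rw [← sum_jacobian_diag κ hN x, Finset.mul_sum, ← Finset.sum_add_distrib]
    rfl
  have h5 := hdet (h • J + B) (hEn.trans (by nlinarith))
  rw [← hA', htr] at h5
  have h6 : c / (4 * (L + 1)) * ‖h • J + B‖ ≤ h * (c / 4) := by
    calc c / (4 * (L + 1)) * ‖h • J + B‖ ≤ c / (4 * (L + 1)) * (h * (L + 1)) := by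
          gcongr; nlinarith
      _ = h * (c / 4) := by field_simp
  have h7 : h * c ≤ h * (κ * (1 - N * R (proj x) ^ 2)) := by gcongr
  have h8 : N * (C * h ^ 2) ≤ h * (c / 4) := by nlinarith
  linarith

end Step

/-! ### Fundamental domains of the torus -/

section Domain

variable {N : ℕ}

/-- The lattice `(2πℤ)^N` of deck transformations of `ℝ^N → 𝕋^N`. -/
noncomputable def periods (N : ℕ) : AddSubgroup (Fin N → ℝ) :=
  AddSubgroup.pi Set.univ fun _ => AddSubgroup.zmultiples (2 * Real.pi)

theorem mem_periods {p : Fin N → ℝ} : p ∈ periods N ↔ proj p = 0 := by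
  simp only [periods, AddSubgroup.mem_pi, Set.mem_univ, forall_const, funext_iff, proj,
    Pi.zero_apply]
  exact forall_congr' fun i => (QuotientAddGroup.eq_zero_iff _).symm

instance countable_periods : Countable (periods N) := by
  have h : ((periods N : AddSubgroup (Fin N → ℝ)) : Set (Fin N → ℝ)).Countable := by
    refine Set.countable_univ_pi fun i => ?_
    exact Set.countable_range _
  exact h.to_subtype

/-- The half-open cube `(0, 2π]^N`; the bound `0 + 2π` is the form used by
`AddCircle.measurePreserving_mk`. -/
noncomputable def cube (N : ℕ) : Set (Fin N → ℝ) :=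
  Set.univ.pi fun _ => Set.Ioc 0 (0 + 2 * Real.pi)

theorem measurableSet_cube : MeasurableSet (cube N) :=
  MeasurableSet.univ_pi fun _ => measurableSet_Ioc

theorem existsUnique_add_mem_cube (x : Fin N → ℝ) :
    ∃! g : periods N, (g : Fin N → ℝ) + x ∈ cube N := by
  choose m hm hu using fun i =>
    existsUnique_add_zsmul_mem_Ioc Real.two_pi_pos (x i) 0
  refine ⟨⟨fun i => m i • (2 * Real.pi), fun i _ => ⟨m i, rfl⟩⟩, fun i _ => ?_, ?_⟩
  · have h : x i + m i • (2 * Real.pi) ∈ Set.Ioc 0 (0 + 2 * Real.pi) := hm i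
    rwa [add_comm (x i)] at h
  · rintro ⟨g, hg⟩ hgx
    ext i
    obtain ⟨k, hk⟩ := hg i trivial
    have h2 := hgx i trivial
    simp only [Pi.add_apply] at h2
    simp only at hk
    have h3 := hu i k (by beta_reduce; rw [hk, add_comm (x i)]; exact h2)
    simp only
    rw [← hk, h3]

theorem isAddFundamentalDomain_cube : IsAddFundamentalDomain (periods N) (cube N) volume :=
  .mk' measurableSet_cube.nullMeasurableSet existsUnique_add_mem_cube

/-- The image of the cube under the lifted flow is again a fundamental domain of the torus. -/
theorem isAddFundamentalDomain_image_cube (κ : ℝ) (ν : Fin N → ℝ) {h : ℝ} (hh : 0 ≤ h) :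
    IsAddFundamentalDomain (periods N) (liftFlow κ ν h '' cube N) volume := by
  have hinv : ∀ x, liftFlow κ ν h (liftFlow κ ν (-h) x) = x := fun x => by
    rw [← liftFlow_add, add_neg_cancel, liftFlow_zero]
  have hmeas : MeasurableSet (liftFlow κ ν h '' cube N) :=
    measurableSet_cube.image_of_continuousOn_injOn
      (lipschitzWith_liftFlow κ ν hh).continuous.continuousOn
      (liftFlow_injective κ ν h).injOn
  refine .mk' hmeas.nullMeasurableSet fun x => ?_
  have hiff : ∀ g : periods N, g +ᵥ x ∈ liftFlow κ ν h '' cube N ↔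
      (g : Fin N → ℝ) + liftFlow κ ν (-h) x ∈ cube N := by
    intro g
    have : g +ᵥ x = liftFlow κ ν h (g + liftFlow κ ν (-h) x) := by
      rw [add_comm, liftFlow_add_period κ ν (mem_periods.1 g.2), hinv, add_comm]
      rfl
    rw [this, (liftFlow_injective κ ν h).mem_set_image]
  simp only [hiff]
  exact existsUnique_add_mem_cube _

theorem measurePreserving_proj :
    MeasurePreserving (proj (N := N)) (volume.restrict (cube N)) volume := by
  have h := measurePreserving_pi
    (fun _ : Fin N => volume.restrict (Set.Ioc (0 : ℝ) (0 + 2 * Real.pi)))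
    (fun _ => volume) fun _ => AddCircle.measurePreserving_mk (2 * Real.pi) 0
  rw [← Measure.restrict_pi_pi] at h
  exact h

theorem isOpenQuotientMap_proj : IsOpenQuotientMap (proj (N := N)) :=
  IsOpenQuotientMap.piMap fun _ => QuotientAddGroup.isOpenQuotientMap_mk

end Domain

/-! ### Forward invariant sets of positive divergence -/

section Invariant

variable {N : ℕ} (κ : ℝ) (ν : Fin N → ℝ)

/-- A forward invariant Borel set on which the divergence of the Kuramoto vector field is bounded
below by a positive constant is a null set: the flow expands its volume but keeps it inside. -/
theorem volume_eq_zero_of_forwardInvariant (hN : 1 ≤ N) {c : ℝ} (hc : 0 < c) {U : Set (Torus N)}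
    (hU : MeasurableSet U) (hinv : ∀ t, 0 ≤ t → ∀ Θ ∈ U, flow κ ν t Θ ∈ U)
    (hdiv : ∀ Θ ∈ U, c ≤ κ * (1 - N * R Θ ^ 2)) : volume U = 0 := by
  obtain ⟨h, h0, hdet⟩ := exists_step_le_det κ ν hN hc
  set S := proj ⁻¹' U with hS
  have hSm : MeasurableSet S := isOpenQuotientMap_proj.continuous.measurable hU
  have hlip := lipschitzWith_liftFlow κ ν h0.le
  have hvol : volume U = volume (S ∩ cube N) := by
    rw [← measurePreserving_proj.measure_preimage hU.nullMeasurableSet, Measure.restrict_apply hSm]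
  have hfin : volume (S ∩ cube N) ≠ ⊤ := by
    rw [← hvol]; exact measure_ne_top _ _
  -- Rademacher's theorem lets the area formula be applied off a null set.
  set D := {x | DifferentiableAt ℝ (liftFlow κ ν h) x}
  have hDm : MeasurableSet D := measurableSet_of_differentiableAt ℝ _
  have hD : ∀ᵐ x, x ∈ D := hlip.ae_differentiableAt
  have hAvol : volume (S ∩ cube N ∩ D) = volume (S ∩ cube N) :=
    measure_inter_conull (by exact hD)
  have harea := lintegral_abs_det_fderiv_eq_addHaar_image volume
    ((hSm.inter measurableSet_cube).inter hDm)
    (fun x hx => (DifferentiableAt.hasFDerivAt hx.2).hasFDerivWithinAt)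
    (liftFlow_injective κ ν h).injOn
  have hlow : ENNReal.ofReal (1 + h * (c / 2)) * volume (S ∩ cube N) ≤
      ∫⁻ x in S ∩ cube N ∩ D, ENNReal.ofReal |(fderiv ℝ (liftFlow κ ν h) x).det| := by
    rw [← hAvol, ← setLIntegral_const]
    refine setLIntegral_mono' ((hSm.inter measurableSet_cube).inter hDm) fun x hx => ?_
    refine ENNReal.ofReal_le_ofReal ((hdet x _ (hdiv _ hx.1.1) ?_).trans (le_abs_self _))
    exact DifferentiableAt.hasFDerivAt hx.2
  have himage : liftFlow κ ν h '' (S ∩ cube N ∩ D) ⊆ S ∩ liftFlow κ ν h '' cube N := by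
    rintro _ ⟨x, hx, rfl⟩
    refine ⟨?_, x, hx.1.2, rfl⟩
    change proj (liftFlow κ ν h x) ∈ U
    rw [← flow_proj]
    exact hinv h h0.le _ hx.1.1
  have hfund : volume (S ∩ liftFlow κ ν h '' cube N) = volume (S ∩ cube N) := by
    refine (isAddFundamentalDomain_image_cube κ ν h0.le).measure_set_eq
      isAddFundamentalDomain_cube hSm fun g => ?_
    ext x
    have : proj (g +ᵥ x) = proj x := by
      rw [← proj_add_of_proj_eq_zero (mem_periods.1 g.2) x, add_comm]; rfl
    simp only [hS, Set.mem_preimage, this]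
  have hle : ENNReal.ofReal (1 + h * (c / 2)) * volume (S ∩ cube N) ≤ volume (S ∩ cube N) :=
    hlow.trans (harea.le.trans ((measure_mono himage).trans hfund.le))
  rw [hvol]
  by_contra hne
  have h1 : ENNReal.ofReal (1 + h * (c / 2)) ≤ 1 := by
    rw [← ENNReal.mul_le_mul_iff_left hne hfin, one_mul]
    exact hle
  rw [ENNReal.ofReal_le_one] at h1
  nlinarith [mul_pos h0 hc]

end Invariant

/-! ### Measurability of the trapped sets -/

section Measurability

variable {N : ℕ} (κ : ℝ) (ν : Fin N → ℝ)

/-- Joint continuity of the flow on the torus for nonnegative times. -/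
theorem continuous_flow :
    Continuous fun p : Set.Ici (0 : ℝ) × Torus N => flow κ ν p.1 p.2 := by
  have hq : IsOpenQuotientMap (Prod.map (id : Set.Ici (0 : ℝ) → _) (proj (N := N))) :=
    IsOpenQuotientMap.id.prodMap isOpenQuotientMap_proj
  rw [hq.isQuotientMap.continuous_iff]
  have : (fun p : Set.Ici (0 : ℝ) × Torus N => flow κ ν p.1 p.2) ∘ Prod.map id proj =
      fun p => proj (liftFlow κ ν p.1 p.2) := by
    funext p
    simp [flow_proj]
  rw [this]
  exact isOpenQuotientMap_proj.continuous.comp (continuous_liftFlow κ ν)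

theorem continuous_R : Continuous (R (N := N)) := by
  rw [isOpenQuotientMap_proj.isQuotientMap.continuous_iff]
  have : (R ∘ proj : (Fin N → ℝ) → ℝ) =
      fun x => ‖(1 / (N : ℂ)) * ∑ j, Complex.exp (x j * Complex.I)‖ := rfl
  rw [this]
  fun_prop

/-- The set of points whose forward orbit stays in an open set is Borel: its complement is a
countable union of projections of compact sets. -/
theorem measurableSet_forall_flow_mem {W : Set (Torus N)} (hW : IsOpen W) :
    MeasurableSet {Θ : Torus N | ∀ t : ℝ, 0 ≤ t → flow κ ν t Θ ∈ W} := by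
  have heq : {Θ : Torus N | ∀ t : ℝ, 0 ≤ t → flow κ ν t Θ ∈ W} =
      ⋂ n : ℕ, {Θ : Torus N | ∀ t ∈ Set.Icc (0 : ℝ) n, flow κ ν t Θ ∈ W} := by
    ext Θ
    simp only [Set.mem_ofPred_eq, Set.mem_iInter, Set.mem_Icc]
    refine ⟨fun h n t ht => h t ht.1, fun h t ht => ?_⟩
    obtain ⟨n, hn⟩ := exists_nat_ge t
    exact h n t ⟨ht, hn⟩
  rw [heq]
  refine MeasurableSet.iInter fun n => IsOpen.measurableSet ?_
  rw [← isClosed_compl_iff]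
  have hcont : Continuous fun p : Set.Icc (0 : ℝ) n × Torus N => flow κ ν p.1 p.2 :=
    (continuous_flow κ ν).comp (f := fun p : Set.Icc (0 : ℝ) n × Torus N =>
      ((⟨p.1, p.1.2.1⟩ : Set.Ici (0 : ℝ)), p.2)) (by fun_prop)
  have himg := isClosedMap_snd_of_compactSpace _ (hW.isClosed_compl.preimage hcont)
  convert himg using 1
  ext Θ
  simp [and_assoc]

end Measurability

end Kuramoto

theorem proposition6p2 (N : ℕ) (hN : 1 ≤ N) (κ : ℝ) (ν : Fin N → ℝ) :
    (0 < κ → ∀ Rs : ℝ, Rs < 1 / Real.sqrt N →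
      MeasurableSet {Θ₀ : Kuramoto.Torus N |
        ∀ t : ℝ, 0 ≤ t → Kuramoto.R (Kuramoto.flow κ ν t Θ₀) < Rs} ∧
      MeasureTheory.volume {Θ₀ : Kuramoto.Torus N |
        ∀ t : ℝ, 0 ≤ t → Kuramoto.R (Kuramoto.flow κ ν t Θ₀) < Rs} = 0) ∧
    (κ < 0 → ∀ Rs : ℝ, 1 / Real.sqrt N < Rs →
      MeasurableSet {Θ₀ : Kuramoto.Torus N |
        ∀ t : ℝ, 0 ≤ t → Rs < Kuramoto.R (Kuramoto.flow κ ν t Θ₀)} ∧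
      MeasureTheory.volume {Θ₀ : Kuramoto.Torus N |
        ∀ t : ℝ, 0 ≤ t → Rs < Kuramoto.R (Kuramoto.flow κ ν t Θ₀)} = 0) := by
  have hN0 : (0 : ℝ) < N := by exact_mod_cast hN
  have hs : (1 / Real.sqrt N) ^ 2 = 1 / (N : ℝ) := by
    rw [div_pow, one_pow, Real.sq_sqrt hN0.le]
  have hs0 : 0 < 1 / Real.sqrt N := by positivity
  have hR0 : ∀ Θ : Kuramoto.Torus N, 0 ≤ Kuramoto.R Θ := fun Θ => norm_nonneg _
  refine ⟨fun hκ Rs hRs => ?_, fun hκ Rs hRs => ?_⟩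
  · have hm := Kuramoto.measurableSet_forall_flow_mem κ ν
      (isOpen_Iio.preimage (Kuramoto.continuous_R (N := N)) : IsOpen (Kuramoto.R ⁻¹' Set.Iio Rs))
    refine ⟨hm, ?_⟩
    -- For `Rs ≤ 0` the set is empty; replacing `Rs` by its positive part covers this case too.
    have hmax : N * max Rs 0 ^ 2 < 1 := by
      have h1 : max Rs 0 ^ 2 < (1 / Real.sqrt N) ^ 2 :=
        pow_lt_pow_left₀ (max_lt hRs hs0) (le_max_right _ _) two_ne_zero
      rw [hs, lt_div_iff₀ hN0] at h1
      linarith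
    refine Kuramoto.volume_eq_zero_of_forwardInvariant κ ν hN
      (c := κ * (1 - N * max Rs 0 ^ 2)) (mul_pos hκ (by linarith)) hm ?_ ?_
    · intro t ht Θ hΘ s hs
      rw [← Kuramoto.flow_add]
      exact hΘ (s + t) (add_nonneg hs ht)
    · intro Θ hΘ
      have h1 : Kuramoto.R Θ < Rs := by simpa [Kuramoto.flow_zero] using hΘ 0 le_rfl
      have h2 := hR0 Θ
      have h3 := h1.le.trans (le_max_left Rs 0)
      gcongr
  · have hm := Kuramoto.measurableSet_forall_flow_mem κ ν
      (isOpen_Ioi.preimage (Kuramoto.continuous_R (N := N)) : IsOpen (Kuramoto.R ⁻¹' Set.Ioi Rs))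
    refine ⟨hm, ?_⟩
    have hRs2 : 1 < N * Rs ^ 2 := by
      have h1 : (1 / Real.sqrt N) ^ 2 < Rs ^ 2 := pow_lt_pow_left₀ hRs hs0.le two_ne_zero
      rw [hs, div_lt_iff₀ hN0] at h1
      linarith
    refine Kuramoto.volume_eq_zero_of_forwardInvariant κ ν hN
      (c := κ * (1 - N * Rs ^ 2)) (mul_pos_of_neg_of_neg hκ (by linarith)) hm ?_ ?_
    · intro t ht Θ hΘ s hs
      rw [← Kuramoto.flow_add]
      exact hΘ (s + t) (add_nonneg hs ht)
    · intro Θ hΘ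
      have h1 : Rs < Kuramoto.R Θ := by simpa [Kuramoto.flow_zero] using hΘ 0 le_rfl
      have h2 : Rs ^ 2 ≤ Kuramoto.R Θ ^ 2 := pow_le_pow_left₀ (hs0.le.trans hRs.le) h1.le 2
      refine mul_le_mul_of_nonpos_left ?_ hκ.le
      gcongr
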